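/- Let $n,k,d,e$ be integers with $k\ge 1$, $e\ge 0$, $k+2e\le d\le n-1$, and let $s=d-2e-k+1$. Let $p$ be a prime and let $p_1,\dots,p_n$ be distinct primes with $p_i\equiv 1 \pmod s$ for all $i$. Put $K_0=\mathbb F_p$ and, for $i=1,\dots,n$, $F_i=K_{i-1}(\alpha_i)$ and $K_i=F_i(\beta_i)$, where $\alpha_i$ is algebraic of degree $p_i$ over $\mathbb F_p$ and $\beta_i$ is algebraic of degree $s$ over $F_i$. Let $\mathbb K=K_n$ and $l=s^n\prod_{i=1}^n p_i$. Let $\mathcal C=\{(f(\alpha_1),\dots,f(\alpha_n)) : f\in\mathbb K[x],\ \deg f<k\}$ be the Reed–Solomon code over $\mathbb K$ with evaluation points $\alpha_1,\dots,\alpha_n$, and let $v=(v_1,\dots,v_n)\in(\mathbb K^\ast)^n$ be such that the dual code is $\mathcal C^\perp=\{(v_1f(\alpha_1),\dots,v_nf(\alpha_n)) : f\in\mathbb K[x],\ \deg f<n-k\}$. For $m=(m_i,\bar m_i)_{i=1}^n$ with $0\le m_i<p_i$ and $0\le\bar m_i<s$ let $$b_m=\prod_{i=1}^n\alpha_i^{m_i}\prod_{i\in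 J(m)}\Big(\sum_{u=0}^{s-1}\beta_i^u\Big)\prod_{i\notin J(m)}\beta_i^{\bar m_i},\qquad J(m)=\{i:(m_i,\bar m_i)=(p_i-1,s-1)\}.$$ Then $(b_m)$ has a trace-dual family $(b_m^\ast)$ (that is, $\operatorname{tr}_{\mathbb K/\mathbb F_p}(b_mb^\ast_{m'})=1$ if $m=m'$ and $0$ otherwise) which is a basis of $\mathbb K$ over $\mathbb F_p$. For a codeword $c\in\mathcal C$ let node $j$ store the $l$ symbols $c_{j,m}\in\mathbb F_p$ defined by $c_j=v_j^{-1}\sum_m c_{j,m}b^\ast_m$. A repair scheme for node $i$ with helper set $R\subseteq\{1,\dots,n\}\setminus\{i\}$ consists, for each $j\in R$, of a set of positions that helper $j$ accesses and a function that maps the symbols in these positions to a vector of symbols of $\mathbb F_p$, which is sent, and of a function that is applied to all vectors received. It tolerates $e$ erroneous helpers if, for every codeword, this function returns the content of node $i$ whenever the vectors received differ from the correct ones for at most $e$ helpers. Its bandwidth is the total number of symbols sent. Then there are sets of positions $A_1,\dots,A_n$, each of size $l/s$, such that for every $i\in\{1,\dots,n\}$ and every $R\subseteq\{1,\dots,n\}\setminus\{i\}$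 with $|R|=d$ there is a repair scheme for node $i$ with helper set $R$ that tolerates $e$ erroneous helpers, has bandwidth $\dfrac{dl}{d-2e-k+1}=\dfrac{dl}{s}$, and in which every helper accesses exactly the positions in $A_i$ (so these depend only on the failed node). The scheme is optimal: no repair scheme for node $i$ with helper set $R$ that tolerates $e$ erroneous helpers has a smaller bandwidth or accesses fewer symbols in total. -/

import Mathlib

namespace RSRepair

/-! ### Codes -/

/-- The generalized Reed-Solomon code `{(v₁ f(α₁), …, vₙ f(αₙ)) : deg f < k}`. -/
noncomputable def GRS {K : Type*} [Field K] {n : ℕ} (k : ℕ) (v α : Fin n → K) :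
    Submodule K (Fin n → K) :=
  (Polynomial.degreeLT K k).map (LinearMap.pi fun j => v j • Polynomial.leval (α j))

/-- The Reed-Solomon code of dimension `k` with evaluation points `α`. -/
noncomputable def RS {K : Type*} [Field K] {n : ℕ} (k : ℕ) (α : Fin n → K) :
    Submodule K (Fin n → K) :=
  GRS k (fun _ => 1) α

/-- The dual code with respect to the standard dot product. -/
def dualCode {K : Type*} [Field K] {n : ℕ} (C : Submodule K (Fin n → K)) :
    Submodule K (Fin n → K) where
  carrier := {x | ∀ c ∈ C, ∑ j, x j * c j = 0}
  zero_mem' := by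
    intro c _
    simp
  add_mem' := by
    intro x y hx hy c hc
    simp [add_mul, Finset.sum_add_distrib, hx c hc, hy c hc]
  smul_mem' := by
    intro a x hx c hc
    have h := hx c hc
    simp [mul_assoc, ← Finset.mul_sum, h]

/-! ### The tower of fields -/

/-- The field generated over `F_p` by all `α_j, β_j` with `j < i`
(the stage of the tower just before the `i`-th pair is adjoined). -/
def stage (p : ℕ) [Fact p.Prime] {K : Type*} [Field K] [Algebra (ZMod p) K] {n : ℕ}
    (α β : Fin n → K) (i : Fin n) : IntermediateField (ZMod p) K :=
  IntermediateField.adjoin (ZMod p) (α '' Set.Iio i ∪ β '' Set.Iio i)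

/-- The field obtained from `stage p α β i` by adjoining `α_i`. -/
def halfStage (p : ℕ) [Fact p.Prime] {K : Type*} [Field K] [Algebra (ZMod p) K] {n : ℕ}
    (α β : Fin n → K) (i : Fin n) : IntermediateField (ZMod p) K :=
  stage p α β i ⊔ IntermediateField.adjoin (ZMod p) {α i}

/-- The data of the construction: distinct primes `P i ≡ 1 (mod s)`, elements `α i` of degree
`P i` over `F_p`, elements `β i` of degree `s` over `F_p(α_j, β_j (j < i), α_i)`, and
`K` is generated over `F_p` by all of them. -/
structure IsTower (p : ℕ) [Fact p.Prime] {K : Type*} [Field K] [Algebra (ZMod p) K] {n : ℕ}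
    (s : ℕ) (P : Fin n → ℕ) (α β : Fin n → K) : Prop where
  prime : ∀ i, (P i).Prime
  distinct : Function.Injective P
  modEq : ∀ i, P i ≡ 1 [MOD s]
  degree_α : ∀ i, (minpoly (ZMod p) (α i)).natDegree = P i
  degree_β : ∀ i, (minpoly (halfStage p α β i) (β i)).natDegree = s
  generate : IntermediateField.adjoin (ZMod p) (Set.range α ∪ Set.range β) = ⊤

/-! ### The storage format -/

/-- Positions of the symbols in a node: `m` is the family of all pairs `(m_i, m̄_i)` with
`0 ≤ m_i < P i` and `0 ≤ m̄_i < s`. There are `s ^ n * ∏ i, P i` of them. -/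
abbrev Pos {n : ℕ} (P : Fin n → ℕ) (s : ℕ) : Type := ∀ i : Fin n, Fin (P i) × Fin s

/-- The element `b_m = ∏ i, α_i ^ m_i * (∑ u < s, β_i ^ u  or  β_i ^ m̄_i)`, where the sum is taken
at those `i` at which `(m_i, m̄_i) = (P i - 1, s - 1)`, and the power at all others. -/
def bElem {K : Type*} [Field K] {n : ℕ} {P : Fin n → ℕ} {s : ℕ} (α β : Fin n → K)
    (m : Pos P s) : K :=
  ∏ i, α i ^ ((m i).1 : ℕ) *
    (if ((m i).1 : ℕ) + 1 = P i ∧ ((m i).2 : ℕ) + 1 = s then ∑ u ∈ Finset.range s, β i ^ u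
      else β i ^ ((m i).2 : ℕ))

/-- The array code over `F` in which node `j` stores the vector `(x_{j,m})_m` of the coordinate
`c_j = v_j⁻¹ * ∑ m, x_{j,m} b*_m` of a codeword `c` of `C`. -/
def arrayCode {F K M : Type*} [Field F] [Field K] [Algebra F K] [Fintype M] {n : ℕ}
    (C : Submodule K (Fin n → K)) (v : Fin n → K) (bs : M → K) : Set (Fin n → M → F) :=
  {x | (fun j => (v j)⁻¹ * ∑ m, x j m • bs m) ∈ C}

/-! ### Repair schemes -/

/-- A repair scheme with set of helpers `R` for nodes that store a vector in `F ^ M`: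
helper `j` reads the symbols in the positions `access j`, sends `β j` symbols of `F` which are
a function `f j` of the symbols read, and `g` computes the content of the failed node. -/
structure RepairScheme (F M : Type*) {n : ℕ} (R : Finset (Fin n)) where
  access : R → Finset M
  β : R → ℕ
  f : ∀ j : R, (access j → F) → (Fin (β j) → F)
  g : (∀ j : R, Fin (β j) → F) → (M → F)

namespace RepairScheme

variable {F M : Type*} {n : ℕ} {R : Finset (Fin n)}

/-- The repair bandwidth: the total number of symbols downloaded. -/
def bandwidth (S : RepairScheme F M R) : ℕ := ∑ j, S.β j

/-- The total number of symbols accessed on the helper nodes. -/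
def totalAccess (S : RepairScheme F M R) : ℕ := ∑ j, (S.access j).card

/-- What the helpers send if all of them are correct and the contents of the nodes are `x`. -/
def sent (S : RepairScheme F M R) (x : Fin n → M → F) : ∀ j : R, Fin (S.β j) → F :=
  fun j => S.f j fun m => x j m

/-- The scheme repairs node `i` of the array code `𝒞` in the presence of at most `e` erroneous
helpers: whatever is received, if it differs from the correct transmissions for at most `e`
helpers then the content of node `i` is recovered. -/
def Repairs [DecidableEq F] (S : RepairScheme F M R) (𝒞 : Set (Fin n → M → F)) (i : Fin n)
    (e : ℕ) : Prop :=
  ∀ x ∈ 𝒞, ∀ y : ∀ j : R, Fin (S.β j) → F, hammingDist y (S.sent x) ≤ e → S.g y = x i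

end RepairScheme

end RSRepair

namespace RSRepair

/-! ### Averaging -/

/-! Let `S` be the span of the `b_m` with `m` in the access set of node `i`. By trace duality,
helper `j` reveals exactly the traces of `y * v_j * c_j` for `y` in `S`. Two properties of `S` carry
the repair: it is stable under `α j` for `j ≠ i` (`mul_mem_repairSpace`), and its translates by `α i
^ t`, `t < s`, generate `K` (`eq_top_of_pow_mul_repairSpace_le`).

Let `E` consist of the non-helpers and any `2e` helpers. The parity checks given by `X ^ t * ∏ r ∈
E, (X - α r)`, `t < s`, have degree below `n - k` and ignore `E`. Multiplied by `y` in `S` and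
traced, they express the traces of `α i ^ t * y * w`, where `w` is a nonzero multiple of `c i`,
through accessed symbols. If these symbols vanish outside `E`, nondegeneracy of the trace gives `c i
= 0` (`eq_zero_of_trace_eq_zero`). So the content of node `i` is determined despite `2e`
disagreements, which is what decoding `e` errors needs.

Optimality is a cut-set bound: zeroing `k - 1` helpers and confusing two groups of `e` leaves `s`
helpers that must convey all `l` symbols; averaging over the `s`-subsets of `R` finishes. -/

/-- If every `s`-element subset of `R` has weight at least `l`, then the average weight of an
element of `R` is at least `l / s`. -/
theorem mul_le_mul_sum_of_forall_card_eq {ι : Type*} [DecidableEq ι] (w : ι → ℕ) {s l : ℕ}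
    (hs : 1 ≤ s) {d : ℕ} (hsd : s ≤ d) (R : Finset ι) (hR : R.card = d)
    (h : ∀ Q ⊆ R, Q.card = s → l ≤ ∑ j ∈ Q, w j) : d * l ≤ s * ∑ j ∈ R, w j := by
  induction d, hsd using Nat.le_induction generalizing R with
  | base => exact Nat.mul_le_mul_left _ (h R subset_rfl hR)
  | succ d hsd ih =>
    have h1 : ∀ r ∈ R, d * l ≤ s * ∑ j ∈ R.erase r, w j := fun r hr =>
      ih (R.erase r) (by rw [Finset.card_erase_of_mem hr, hR]; rfl)
        fun Q hQ hc => h Q (hQ.trans (Finset.erase_subset _ _)) hc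
    have h2 := Finset.sum_le_sum h1
    -- Double counting: each element survives all erasures but its own.
    have h3 : ∑ r ∈ R, ∑ j ∈ R.erase r, w j + ∑ j ∈ R, w j = (d + 1) * ∑ j ∈ R, w j := by
      rw [← Finset.sum_add_distrib, Finset.sum_congr rfl fun r hr => Finset.sum_erase_add R w hr,
        Finset.sum_const, hR, smul_eq_mul]
    rw [Finset.sum_const, hR, smul_eq_mul, ← Finset.mul_sum] at h2
    have h4 : ∑ r ∈ R, ∑ j ∈ R.erase r, w j = d * ∑ j ∈ R, w j := by linarith
    rw [h4] at h2
    have hd : 0 < d := by omega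
    refine Nat.le_of_mul_le_mul_left ?_ hd
    linarith

namespace RepairScheme

variable {F M : Type*} {n : ℕ} {R : Finset (Fin n)}

/-! ### Existence of a decoder -/

/-- If any two words of the code whose restrictions to the positions in `A` agree on all but at
most `2e` helpers have the same content at node `i`, then the scheme in which the helpers send
their symbols in the positions `A` can be completed by a decoder that tolerates `e` errors. -/
theorem exists_repairs_of_access [DecidableEq F] [Nonempty F] (𝒞 : Set (Fin n → M → F))
    (i : Fin n) (e : ℕ) (A : Finset M)
    (h : ∀ x ∈ 𝒞, ∀ x' ∈ 𝒞, ∀ B : Finset R, B.card ≤ 2 * e →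
      (∀ j : R, j ∉ B → ∀ m ∈ A, x j m = x' j m) → x i = x' i) :
    ∃ S : RepairScheme F M R, S.Repairs 𝒞 i e ∧ (∀ j, S.access j = A) ∧
      S.bandwidth = R.card * A.card ∧ S.totalAccess = R.card * A.card := by
  classical
  let f : ∀ _ : R, (A → F) → (Fin A.card → F) := fun _ a t => a (A.equivFin.symm t)
  let snt : (Fin n → M → F) → R → Fin A.card → F := fun x j => f j fun m => x j m
  -- Any codeword within distance `e` will do: two such differ on at most `2e` helpers, so `h` makes
  -- them agree at `i`. The default is used only for words outside every decoding ball.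
  let g : (R → Fin A.card → F) → M → F := fun y =>
    if hy : ∃ x ∈ 𝒞, hammingDist y (snt x) ≤ e then hy.choose i
    else fun _ => Classical.arbitrary F
  refine ⟨⟨fun _ => A, fun _ => A.card, f, g⟩, ?_, fun _ => rfl, ?_, ?_⟩
  · intro x hx y hxy
    have hy : ∃ x ∈ 𝒞, hammingDist y (snt x) ≤ e := ⟨x, hx, hxy⟩
    change g y = x i
    have hg : g y = hy.choose i := dif_pos hy
    rw [hg]
    obtain ⟨h1, h2⟩ := hy.choose_spec
    refine h _ h1 _ hx (Finset.univ.filter fun j => snt hy.choose j ≠ snt x j) ?_ ?_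
    · have h3 : hammingDist y (snt x) ≤ e := hxy
      have := hammingDist_triangle_left (snt hy.choose) (snt x) y
      have h4 : hammingDist (snt hy.choose) (snt x) ≤ 2 * e := by omega
      exact h4
    · intro j hj m hm
      have : snt hy.choose j = snt x j := by simpa using hj
      simpa [snt, f] using congrFun this (A.equivFin ⟨m, hm⟩)
  · simp [bandwidth]
  · simp [totalAccess]

/-! ### The cut-set bound -/

/-- A set of helpers which, together with some helpers whose content does not determine anything
about node `i`, leaves out only `2e` helpers has to send (and hence to read) at least as many
symbols as a node stores. -/
theorem card_le_sum_of_repairs [Fintype F] [DecidableEq F] [Nontrivial F] [Zero F] [Fintype M]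
    {𝒞 : Set (Fin n → M → F)} {i : Fin n} {e : ℕ} {S : RepairScheme F M R}
    (hS : S.Repairs 𝒞 i e) {k : ℕ}
    (h𝒞 : ∀ H : Finset (Fin n), i ∉ H → H.card + 1 ≤ k →
      ∀ z : M → F, ∃ x ∈ 𝒞, x i = z ∧ ∀ j ∈ H, x j = 0)
    (hi : i ∉ R) (Q : Finset R) (hQ : R.card + 1 ≤ Q.card + k + 2 * e) (hk : 1 ≤ k) :
    Fintype.card M ≤ ∑ j ∈ Q, S.β j ∧ Fintype.card M ≤ ∑ j ∈ Q, (S.access j).card := by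
  classical
  have hcard : Qᶜ.card ≤ (k - 1) + (e + e) := by
    rw [Finset.card_compl, Fintype.card_coe]
    omega
  obtain ⟨H, E₁, E₂, hH, hE₁, hE₂, hcov⟩ : ∃ H E₁ E₂ : Finset R, H.card ≤ k - 1 ∧ E₁.card ≤ e ∧
      E₂.card ≤ e ∧ ∀ j, j ∉ Q → j ∉ H → j ∉ E₁ → j ∈ E₂ := by
    obtain ⟨H, hHs, hH⟩ := Finset.exists_subset_card_eq (s := Qᶜ) (n := min (k - 1) Qᶜ.card)
      (min_le_right _ _)
    obtain ⟨E, hEs, hE⟩ := Finset.exists_subset_card_eq (s := Qᶜ \ H)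
      (n := min e (Qᶜ \ H).card) (min_le_right _ _)
    refine ⟨H, E, (Qᶜ \ H) \ E, by omega, by omega, ?_, ?_⟩
    · rw [Finset.card_sdiff_of_subset hEs, hE]
      have := Finset.card_sdiff_of_subset hHs
      omega
    · intro j h1 h2 h3
      simp [h1, h2, h3]
  choose x hx hxi hxH using h𝒞 (H.map (Function.Embedding.subtype _)) (by
      simp only [Finset.mem_map, Function.Embedding.coe_subtype, not_exists, not_and]
      rintro ⟨j, hj⟩ _ rfl
      exact hi hj) (by rw [Finset.card_map]; omega)
  have key : ∀ z z', (∀ j ∈ Q, S.sent (x z) j = S.sent (x z') j) → z = z' := by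
    intro z z' hzz
    -- A hybrid word: the two transmissions agree on `Q` and on `H`, so it is within `e` of one
    -- because of `E₁` and of the other because of `E₂`. The decoder must then output both `z` and
    -- `z'`.
    let y : ∀ j : R, Fin (S.β j) → F := fun j =>
      if j ∈ E₁ then S.sent (x z) j else S.sent (x z') j
    have hHsent : ∀ j ∈ H, S.sent (x z) j = S.sent (x z') j := by
      intro j hj
      have hj' : (j : Fin n) ∈ H.map (Function.Embedding.subtype _) :=
        Finset.mem_map_of_mem _ hj
      simp only [sent, hxH z j hj', hxH z' j hj']
    have h1 : hammingDist y (S.sent (x z')) ≤ e := by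
      refine (Finset.card_le_card ?_).trans hE₁
      intro j hj
      by_contra hjE
      simp [y, hjE] at hj
    have h2 : hammingDist y (S.sent (x z)) ≤ e := by
      refine (Finset.card_le_card ?_).trans hE₂
      intro j hj
      by_cases hjE : j ∈ E₁
      · simp [y, hjE] at hj
      · simp only [y, hjE, if_false, Finset.mem_filter, Finset.mem_univ, true_and] at hj
        exact hcov j (fun h => hj (hzz j h).symm) (fun h => hj (hHsent j h).symm) hjE
    rw [← hxi z, ← hxi z', ← hS _ (hx z) y h2, hS _ (hx z') y h1]
  have hF : 1 < Fintype.card F := Fintype.one_lt_card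
  constructor
  · have := Fintype.card_le_of_injective
      (fun (z : M → F) (j : Q) => S.sent (x z) j)
      (fun z z' hzz => key z z' fun j hj => congrFun hzz ⟨j, hj⟩)
    simp only [Fintype.card_fun, Fintype.card_pi, Fintype.card_fin, Finset.prod_pow_eq_pow_sum]
      at this
    rw [Nat.pow_le_pow_iff_right hF] at this
    rwa [Finset.sum_coe_sort Q fun j => S.β j] at this
  · have := Fintype.card_le_of_injective
      (fun (z : M → F) (j : Q) (m : S.access (j : R)) => x z j m)
      (fun z z' hzz => key z z' fun j hj => by
        have := congrFun hzz ⟨j, hj⟩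
        simp only [sent]
        exact congrArg (S.f j) this)
    simp only [Fintype.card_fun, Fintype.card_pi, Fintype.card_coe, Finset.prod_pow_eq_pow_sum]
      at this
    rw [Nat.pow_le_pow_iff_right hF] at this
    rwa [Finset.sum_coe_sort Q fun j => (S.access j).card] at this

/-- The cut-set bound for the bandwidth and for the number of symbols accessed. -/
theorem mul_card_le_of_repairs [Fintype F] [DecidableEq F] [Nontrivial F] [Zero F] [Fintype M]
    {𝒞 : Set (Fin n → M → F)} {i : Fin n} {e : ℕ} {S : RepairScheme F M R}
    (hS : S.Repairs 𝒞 i e) {k s : ℕ}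
    (h𝒞 : ∀ H : Finset (Fin n), i ∉ H → H.card + 1 ≤ k →
      ∀ z : M → F, ∃ x ∈ 𝒞, x i = z ∧ ∀ j ∈ H, x j = 0)
    (hi : i ∉ R) (hk : 1 ≤ k) (hs : 1 ≤ s) (hR : R.card + 1 = s + k + 2 * e) :
    R.card * Fintype.card M ≤ s * S.bandwidth ∧
      R.card * Fintype.card M ≤ s * S.totalAccess := by
  classical
  have hbd := fun (Q : Finset R) (hQ : Q.card = s) =>
    card_le_sum_of_repairs hS h𝒞 hi Q (by omega) hk
  have hc : (Finset.univ : Finset R).card = R.card := by simp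
  exact ⟨mul_le_mul_sum_of_forall_card_eq S.β hs (by omega) _ hc fun Q _ hQ => (hbd Q hQ).1,
    mul_le_mul_sum_of_forall_card_eq (fun j => (S.access j).card) hs (by omega) _ hc
      fun Q _ hQ => (hbd Q hQ).2⟩

end RepairScheme

open Polynomial IntermediateField

/-! ### Spanning by monomials in two elements -/

section Span

variable {F K : Type*} [Field F] [Field K] [Algebra F K]

/-- The factor of `b_m` that belongs to one of the levels of the tower. -/
def bFactor {P s : ℕ} (a b : K) (x : Fin P × Fin s) : K :=
  a ^ (x.1 : ℕ) *
    (if (x.1 : ℕ) + 1 = P ∧ (x.2 : ℕ) + 1 = s then ∑ u ∈ Finset.range s, b ^ u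
      else b ^ (x.2 : ℕ))

theorem bElem_update {n : ℕ} {P : Fin n → ℕ} {s : ℕ} (α β : Fin n → K) (m : Pos P s)
    (j : Fin n) (x : Fin (P j) × Fin s) :
    bElem α β (Function.update m j x) = bFactor (α j) (β j) x *
      ∏ r ∈ Finset.univ.erase j, bFactor (α r) (β r) (m r) := by
  change ∏ r, bFactor (α r) (β r) (Function.update m j x r) = _
  rw [← Finset.mul_prod_erase _ _ (Finset.mem_univ j), Function.update_self]
  congr 1
  refine Finset.prod_congr rfl fun r hr => ?_
  rw [Function.update_of_ne (Finset.ne_of_mem_erase hr)]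

theorem bElem_eq {n : ℕ} {P : Fin n → ℕ} {s : ℕ} (α β : Fin n → K) (m : Pos P s) (j : Fin n) :
    bElem α β m = bFactor (α j) (β j) (m j) *
      ∏ r ∈ Finset.univ.erase j, bFactor (α r) (β r) (m r) := by
  conv_lhs => rw [← Function.update_eq_self j m]
  exact bElem_update α β m j (m j)

/-- Every element of `F[a]` is a polynomial expression in `a` of degree less than the degree
of `a`. -/
theorem exists_natDegree_lt_aeval_eq {a : K} (ha : 0 < (minpoly F a).natDegree) {y : K}
    (hy : y ∈ F⟮a⟯) : ∃ q : F[X], q.natDegree < (minpoly F a).natDegree ∧ aeval a q = y := by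
  have hint : IsIntegral F a := by
    by_contra h
    simp [minpoly.eq_zero h] at ha
  have hy' : y ∈ F⟮a⟯.toSubalgebra := hy
  rw [adjoin_simple_toSubalgebra_of_isAlgebraic hint.isAlgebraic,
    Algebra.adjoin_singleton_eq_range_aeval] at hy'
  obtain ⟨q, rfl⟩ := hy'
  refine ⟨q %ₘ minpoly F a, natDegree_modByMonic_lt _ (minpoly.monic hint) ?_, ?_⟩
  · intro h
    simp [h] at ha
  · have := modByMonic_add_div q (minpoly F a)
    conv_rhs => erw [← this]
    simp

/-- A subspace that contains `a ^ t * x` for `deg a` consecutive exponents `t` contains it for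
all `t`. -/
theorem pow_mul_mem_of_consecutive (T : Submodule F K) {a : K} (ha0 : a ≠ 0)
    (ha : 0 < (minpoly F a).natDegree) (x : K) (u : ℕ)
    (h : ∀ t < (minpoly F a).natDegree, a ^ (u + t) * x ∈ T) (t : ℕ) : a ^ t * x ∈ T := by
  have hmem : a ∈ F⟮a⟯ := mem_adjoin_simple_self F a
  -- Working with the quotient `a ^ t / a ^ u` in `F⟮a⟯` also covers exponents `t < u`.
  obtain ⟨q, hq, hqa⟩ := exists_natDegree_lt_aeval_eq ha
    (div_mem (pow_mem hmem t) (pow_mem hmem u))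
  have : a ^ t * x = a ^ u * (aeval a q * x) := by
    rw [hqa]
    field_simp
  rw [this, aeval_eq_sum_range' hq, Finset.sum_mul, Finset.mul_sum]
  refine Submodule.sum_mem _ fun r hr => ?_
  have h2 : a ^ u * (q.coeff r • a ^ r * x) = q.coeff r • (a ^ (u + r) * x) := by
    rw [pow_add, smul_mul_assoc, mul_smul_comm, mul_assoc]
  rw [h2]
  exact T.smul_mem _ (h r (Finset.mem_range.mp hr))

/-- The elements `bFactor a b x` span the monomials `a ^ r * b ^ u`, `u < s`. -/
theorem monomial_mul_mem_of_bFactor {P s : ℕ} (T : Submodule F K) {a b : K} (ha0 : a ≠ 0)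
    (ha : (minpoly F a).natDegree = P) (hP : 0 < P) (γ : K)
    (h : ∀ x : Fin P × Fin s, bFactor a b x * γ ∈ T) (r u : ℕ) (hu : u < s) :
    a ^ r * (b ^ u * γ) ∈ T := by
  have h1 : ∀ t u, t < P → u < s → ¬ (t + 1 = P ∧ u + 1 = s) → a ^ t * (b ^ u * γ) ∈ T := by
    intro t u ht hu hn
    have := h (⟨t, ht⟩, ⟨u, hu⟩)
    rw [bFactor, if_neg hn, mul_assoc] at this
    exact this
  refine pow_mul_mem_of_consecutive T ha0 (ha ▸ hP) _ 0 (fun t ht => ?_) r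
  rw [ha] at ht
  rw [zero_add]
  by_cases hc : t + 1 = P ∧ u + 1 = s
  · have h2 := h (⟨t, ht⟩, ⟨u, hu⟩)
    rw [bFactor, if_pos hc] at h2
    -- In the exceptional position, removing the terms `b ^ w` with `w < s - 1` from the sum
    -- isolates `b ^ (s - 1)`.
    simp only [← hc.2] at h2 h1
    rw [Finset.sum_range_succ, mul_add, add_mul, mul_assoc, mul_assoc] at h2
    refine (Submodule.add_mem_iff_right T ?_).mp h2
    rw [Finset.sum_mul, Finset.mul_sum]
    refine Submodule.sum_mem _ fun w hw => ?_
    have := Finset.mem_range.mp hw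
    exact h1 t w ht (by omega) (by omega)
  · exact h1 t u ht hu hc

/-- The subspaces `a ^ t * S`, `t < s`, generate all monomials, where `S` is spanned by the
`a ^ (q * s + u) * b ^ u` and by `a ^ (P - 1) * ∑ v, b ^ v`. -/
theorem monomial_mul_mem_of_diagonal {N s : ℕ} (T : Submodule F K) {a b : K} (ha0 : a ≠ 0)
    (ha : (minpoly F a).natDegree = N * s + 1) (hN : 0 < N) (γ : K)
    (h1 : ∀ q < N, ∀ u < s, ∀ t < s, a ^ t * (a ^ (q * s + u) * b ^ u * γ) ∈ T)
    (h2 : ∀ t < s, a ^ t * (a ^ (N * s) * (∑ v ∈ Finset.range s, b ^ v) * γ) ∈ T)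
    (u : ℕ) (hu : u < s) : ∀ r : ℕ, a ^ r * (b ^ u * γ) ∈ T := by
  -- Division of `r - v` by `s` gives the block `q` and the shift `t`. This yields `N * s`
  -- consecutive exponents for each `b ^ v`, one fewer than the degree of `a`.
  have hlow : ∀ v < s, ∀ r, v ≤ r → r < v + N * s → a ^ r * (b ^ v * γ) ∈ T := by
    intro v hv r h3 h4
    have hs : 0 < s := by omega
    have h5 := h1 ((r - v) / s) ((Nat.div_lt_iff_lt_mul hs).mpr (by omega)) v hv ((r - v) % s)
      (Nat.mod_lt _ hs)
    have h6 : (r - v) % s + ((r - v) / s * s + v) = r := by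
      have := Nat.div_add_mod' (r - v) s
      omega
    rwa [mul_assoc, ← mul_assoc, ← pow_add, h6] at h5
  have hNs : s ≤ N * s := Nat.le_mul_of_pos_left s hN
  induction u using Nat.strong_induction_on with
  | _ u ih =>
    refine pow_mul_mem_of_consecutive T ha0 (by omega) _ u fun t ht => ?_
    rw [ha] at ht
    rcases Nat.lt_or_ge t (N * s) with ht' | ht'
    · exact hlow u hu _ (by omega) (by omega)
    -- The missing exponent `u + N * s` comes from the sum shifted by `a ^ u`. Its terms with `v <
    -- u` are known by induction; for `v > u` the exponent lies in the window of `hlow`.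
    · have h3 := h2 u hu
      rw [mul_assoc, ← mul_assoc, ← pow_add, Finset.sum_mul, Finset.mul_sum,
        ← Finset.add_sum_erase _ _ (Finset.mem_range.mpr hu)] at h3
      have h4 : t = N * s := by omega
      rw [h4]
      refine (Submodule.add_mem_iff_left T ?_).mp h3
      refine Submodule.sum_mem _ fun v hv => ?_
      have hv1 := Finset.ne_of_mem_erase hv
      have hv2 := Finset.mem_range.mp (Finset.mem_of_mem_erase hv)
      rcases Nat.lt_or_ge v u with hvu | hvu
      · exact ih v hvu hv2 _
      · exact hlow v hv2 _ (by omega) (by omega)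

end Span

/-! ### Adjoining one element to an intermediate field -/

section Tower

variable {F K : Type*} [Field F] [Field K] [Algebra F K]

theorem finrank_sup_adjoin_simple (E : IntermediateField F K) {a : K}
    (ha : 0 < (minpoly E a).natDegree) :
    Module.finrank F ↥(E ⊔ F⟮a⟯) = Module.finrank F E * (minpoly E a).natDegree := by
  have hint : IsIntegral E a := by
    by_contra h
    simp [minpoly.eq_zero h] at ha
  rw [← restrictScalars_adjoin_eq_sup, ← adjoin.finrank hint]
  exact (Module.finrank_mul_finrank F E E⟮a⟯).symm

theorem exists_natDegree_lt_of_mem_sup (E : IntermediateField F K) {a : K}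
    (ha : 0 < (minpoly E a).natDegree) {y : K} (hy : y ∈ E ⊔ F⟮a⟯) :
    ∃ q : E[X], q.natDegree < (minpoly E a).natDegree ∧ aeval a q = y := by
  rw [← restrictScalars_adjoin_eq_sup] at hy
  exact exists_natDegree_lt_aeval_eq ha hy

theorem natDegree_minpoly_pos_of_tower (E : IntermediateField F K) {a : K}
    (ha : 0 < (minpoly F a).natDegree) : 0 < (minpoly E a).natDegree := by
  have hint : IsIntegral F a := by
    by_contra h
    simp [minpoly.eq_zero h] at ha
  exact minpoly.natDegree_pos hint.tower_top

end Tower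

/-! ### Degree and basis of the tower -/

section Chain

variable (p : ℕ) [Fact p.Prime] {K : Type*} [Field K] [Algebra (ZMod p) K] {n : ℕ}

/-- The field generated by the first `r` pairs `α_j, β_j`. -/
def level (α β : Fin n → K) (r : ℕ) : IntermediateField (ZMod p) K :=
  adjoin (ZMod p) (α '' {j | (j : ℕ) < r} ∪ β '' {j | (j : ℕ) < r})

theorem level_eq_stage (α β : Fin n → K) (i : Fin n) : level p α β i = stage p α β i := rfl

theorem level_zero (α β : Fin n → K) : level p α β 0 = ⊥ := by
  simp [level]

theorem level_succ (α β : Fin n → K) (i : Fin n) :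
    level p α β (i + 1) = halfStage p α β i ⊔ adjoin (ZMod p) {β i} := by
  have : {j : Fin n | (j : ℕ) < i + 1} = {i} ∪ {j : Fin n | (j : ℕ) < i} := by
    ext j
    simp only [Set.mem_ofPred_eq, Set.singleton_union, Set.mem_insert_iff, Fin.ext_iff]
    omega
  rw [level, halfStage, ← level_eq_stage, level, this]
  simp only [Set.image_union, Set.image_singleton, adjoin_union]
  ac_rfl

namespace IsTower

variable {p} {s : ℕ} {P : Fin n → ℕ} {α β : Fin n → K}

theorem level_eq_top (hT : IsTower p s P α β) : level p α β n = ⊤ := by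
  rw [← hT.generate, level]
  congr 2 <;> simp

theorem α_ne_zero (hT : IsTower p s P α β) (i : Fin n) : α i ≠ 0 := by
  intro h
  have h1 := hT.degree_α i
  rw [h, minpoly.zero, natDegree_X] at h1
  exact (hT.prime i).one_lt.ne h1

theorem α_injective (hT : IsTower p s P α β) : Function.Injective α := by
  intro i j h
  apply hT.distinct
  rw [← hT.degree_α i, ← hT.degree_α j, h]

theorem coprime_P_s (hT : IsTower p s P α β) (i : Fin n) : (P i).Coprime s := by
  have h := (hT.modEq i).gcd_eq
  rw [Nat.Coprime, h, Nat.gcd_one_left]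

/-- The degree of `α i` is prescribed only over `F_p`; coprime degrees make the two fields linearly
disjoint, so it persists over the stage. -/
theorem finrank_halfStage (hT : IsTower p s P α β) (i : Fin n)
    (h : (P i).Coprime (Module.finrank (ZMod p) (stage p α β i))) :
    Module.finrank (ZMod p) (halfStage p α β i) =
      Module.finrank (ZMod p) (stage p α β i) * P i := by
  have hint : IsIntegral (ZMod p) (α i) := by
    by_contra h
    have := hT.degree_α i
    rw [minpoly.eq_zero h, natDegree_zero] at this
    exact (hT.prime i).ne_zero this.symm
  have h1 : Module.finrank (ZMod p) (adjoin (ZMod p) {α i}) = P i := by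
    rw [adjoin.finrank hint, hT.degree_α]
  rw [halfStage, (LinearDisjoint.of_finrank_coprime (by rw [h1]; exact h.symm)).finrank_sup, h1]

theorem finrank_level (hT : IsTower p s P α β) (hs : 0 < s) (r : ℕ) (hr : r ≤ n) :
    Module.finrank (ZMod p) (level p α β r) =
      ∏ j ∈ Finset.univ.filter (fun j : Fin n => (j : ℕ) < r), (P j * s) := by
  induction r with
  | zero => simp [level_zero]
  | succ r ih =>
    let i : Fin n := ⟨r, hr⟩
    have ih := ih (by omega)
    have hcop : (P i).Coprime (Module.finrank (ZMod p) (stage p α β i)) := by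
      rw [← level_eq_stage, ih]
      refine Nat.Coprime.prod_right fun j hj => ?_
      refine Nat.Coprime.mul_right ?_ (hT.coprime_P_s i)
      refine (Nat.coprime_primes (hT.prime i) (hT.prime j)).mpr fun h => ?_
      have h1 : i = j := hT.distinct h
      have h2 := (Finset.mem_filter.mp hj).2
      rw [← h1] at h2
      exact lt_irrefl _ h2
    have h1 := level_succ p α β i
    have h2 : Finset.univ.filter (fun j : Fin n => (j : ℕ) < r + 1) =
        insert i (Finset.univ.filter (fun j : Fin n => (j : ℕ) < r)) := by
      ext j
      simp only [Finset.mem_filter, Finset.mem_univ, true_and, Finset.mem_insert, Fin.ext_iff, i]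
      omega
    rw [h2, Finset.prod_insert (by simp [i]), ← ih]
    change Module.finrank (ZMod p) (level p α β (i + 1)) = _
    rw [h1, finrank_sup_adjoin_simple _ (by rw [hT.degree_β]; exact hs), hT.degree_β,
      hT.finrank_halfStage i hcop, ← level_eq_stage]
    ring

theorem finrank_eq (hT : IsTower p s P α β) (hs : 0 < s) :
    Module.finrank (ZMod p) K = ∏ j, (P j * s) := by
  have h := hT.finrank_level hs n le_rfl
  rw [hT.level_eq_top, finrank_top'] at h
  rw [h]
  congr 1
  simp

theorem finiteDimensional (hT : IsTower p s P α β) (hs : 0 < s) :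
    FiniteDimensional (ZMod p) K := by
  refine Module.finite_of_finrank_pos ?_
  rw [hT.finrank_eq hs]
  exact Finset.prod_pos fun j _ => Nat.mul_pos (hT.prime j).pos hs

/-- Multiplication by the elements of `level r` maps the product of the last factors into the
span of the `b_m`. -/
theorem mul_prod_mem_span (hT : IsTower p s P α β) (hs : 0 < s) (r : ℕ) (hr : r ≤ n) :
    ∀ x ∈ level p α β r, ∀ m : Pos P s,
      x * ∏ j ∈ Finset.univ.filter (fun j : Fin n => r ≤ (j : ℕ)), bFactor (α j) (β j) (m j) ∈
        Submodule.span (ZMod p) (Set.range (bElem α β : Pos P s → K)) := by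
  induction r with
  | zero =>
    intro x hx m
    rw [level_zero, mem_bot] at hx
    obtain ⟨c, rfl⟩ := hx
    rw [← Algebra.smul_def]
    refine Submodule.smul_mem _ _ (Submodule.subset_span ⟨m, ?_⟩)
    simp only [Nat.zero_le, Finset.filter_true]
    rfl
  | succ r ih =>
    intro x hx m
    let i : Fin n := ⟨r, hr⟩
    have ih := ih (by omega)
    set T := Submodule.span (ZMod p) (Set.range (bElem α β : Pos P s → K))
    set γ := ∏ j ∈ Finset.univ.filter (fun j : Fin n => r + 1 ≤ (j : ℕ)),
      bFactor (α j) (β j) (m j) with hγ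
    have hfil : Finset.univ.filter (fun j : Fin n => r ≤ (j : ℕ)) =
        insert i (Finset.univ.filter (fun j : Fin n => r + 1 ≤ (j : ℕ))) := by
      ext j
      simp only [Finset.mem_filter, Finset.mem_univ, true_and, Finset.mem_insert, Fin.ext_iff, i]
      omega
    -- The induction hypothesis holds for every `m`, so the `i`-th factor can be varied while `γ`
    -- stays fixed. Expanding in powers of `β i`, then of `α i`, reduces the next level to this.
    have h1 : ∀ z ∈ level p α β r, ∀ y : Fin (P i) × Fin s,
        bFactor (α i) (β i) y * (z * γ) ∈ T := by
      intro z hz y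
      have := ih z hz (Function.update m i y)
      rw [hfil, Finset.prod_insert (by simp [i]), Function.update_self] at this
      rw [mul_left_comm]
      convert this using 3
      refine Finset.prod_congr rfl fun j hj => ?_
      rw [Function.update_of_ne]
      rintro rfl
      simp [i] at hj
    have h2 : ∀ z ∈ level p α β r, ∀ t, ∀ u < s, α i ^ t * (β i ^ u * (z * γ)) ∈ T :=
      fun z hz t u hu => monomial_mul_mem_of_bFactor T (hT.α_ne_zero i) (hT.degree_α i)
        (hT.prime i).pos _ (h1 z hz) t u hu
    have h3 : ∀ y ∈ halfStage p α β i, ∀ u < s, y * (β i ^ u * γ) ∈ T := by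
      intro y hy u hu
      have hd : 0 < (minpoly (ZMod p) (α i)).natDegree := by
        rw [hT.degree_α]
        exact (hT.prime i).pos
      obtain ⟨q, -, rfl⟩ := exists_natDegree_lt_of_mem_sup _
        (natDegree_minpoly_pos_of_tower (stage p α β i) hd) hy
      rw [aeval_eq_sum_range, Finset.sum_mul]
      refine Submodule.sum_mem _ fun t _ => ?_
      have := h2 (q.coeff t) (q.coeff t).2 t u hu
      convert this using 1
      rw [Algebra.smul_def, IntermediateField.algebraMap_apply]
      ring
    have h4 := level_succ p α β i
    change x ∈ level p α β (i + 1) at hx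
    rw [h4] at hx
    obtain ⟨q, hq, rfl⟩ := exists_natDegree_lt_of_mem_sup _ (by rw [hT.degree_β]; exact hs) hx
    rw [hT.degree_β] at hq
    rw [aeval_eq_sum_range' hq, Finset.sum_mul]
    refine Submodule.sum_mem _ fun u hu => ?_
    have := h3 (q.coeff u) (q.coeff u).2 u (Finset.mem_range.mp hu)
    convert this using 1
    rw [Algebra.smul_def, IntermediateField.algebraMap_apply]
    ring

theorem span_bElem (hT : IsTower p s P α β) (hs : 0 < s) :
    Submodule.span (ZMod p) (Set.range (bElem α β : Pos P s → K)) = ⊤ := by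
  refine eq_top_iff.mpr fun x _ => ?_
  have m : Pos P s := fun i => (⟨0, (hT.prime i).pos⟩, ⟨0, hs⟩)
  have h := hT.mul_prod_mem_span hs n le_rfl x (by rw [hT.level_eq_top]; trivial) m
  rw [Finset.filter_false_of_mem (fun j _ => by omega), Finset.prod_empty, mul_one] at h
  exact h

/-- Independence is free: the number of positions equals the degree of `K`. -/
theorem exists_basis (hT : IsTower p s P α β) (hs : 0 < s) :
    ∃ b : Module.Basis (Pos P s) (ZMod p) K, ⇑b = bElem α β := by
  refine ⟨basisOfTopLeSpanOfCardEqFinrank (bElem α β) (hT.span_bElem hs).ge ?_, ?_⟩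
  · rw [hT.finrank_eq hs]
    simp
  · exact coe_basisOfTopLeSpanOfCardEqFinrank _ _ _

end IsTower

end Chain

/-! ### The accessed positions -/

/-- The positions `(a, u)` in one level of the tower that are accessed to repair the node that
belongs to this level. -/
def diagonal (P s : ℕ) : Finset (Fin P × Fin s) :=
  Finset.univ.filter fun x =>
    ((x.1 : ℕ) + 1 = P ∧ (x.2 : ℕ) + 1 = s) ∨ ((x.1 : ℕ) + 1 ≠ P ∧ (x.1 : ℕ) % s = x.2)

/-- Each first coordinate admits exactly one second coordinate. -/
theorem card_diagonal {P s : ℕ} (hs : 0 < s) : (diagonal P s).card = P := by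
  conv_rhs => rw [← Fintype.card_fin P, ← Finset.card_univ]
  refine Finset.card_bij (fun x _ => x.1) (fun _ _ => Finset.mem_univ _) ?_ ?_
  · rintro ⟨a, u⟩ h ⟨a', u'⟩ h' (rfl : a = a')
    simp only [diagonal, Finset.mem_filter, Finset.mem_univ, true_and] at h h'
    have : u = u' := Fin.ext (by omega)
    rw [this]
  · intro a _
    by_cases h : (a : ℕ) + 1 = P
    · exact ⟨(a, ⟨s - 1, by omega⟩), by simp [diagonal, h]; omega, rfl⟩
    · exact ⟨(a, ⟨a % s, Nat.mod_lt _ hs⟩), by simp [diagonal, h], rfl⟩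

/-- The positions accessed to repair node `i`. -/
def accessSet {n : ℕ} (P : Fin n → ℕ) (s : ℕ) (i : Fin n) : Finset (Pos P s) :=
  Fintype.piFinset fun j => if j = i then diagonal (P j) s else Finset.univ

theorem mem_accessSet {n : ℕ} {P : Fin n → ℕ} {s : ℕ} {i : Fin n} {m : Pos P s} :
    m ∈ accessSet P s i ↔ m i ∈ diagonal (P i) s := by
  rw [accessSet, Fintype.mem_piFinset]
  constructor
  · intro h
    simpa using h i
  · intro h j
    by_cases hj : j = i
    · subst hj
      simpa using h
    · simp [hj]

theorem mul_card_accessSet {n : ℕ} (P : Fin n → ℕ) {s : ℕ} (hs : 0 < s) (i : Fin n) :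
    s * (accessSet P s i).card = s ^ n * ∏ j, P j := by
  have h1 : ∀ j ∈ Finset.univ.erase i,
      (if j = i then diagonal (P j) s else Finset.univ).card = P j * s := by
    intro j hj
    simp [Finset.ne_of_mem_erase hj]
  have h2 : s ^ n * ∏ j, P j = ∏ j, (P j * s) := by
    rw [Finset.prod_mul_distrib, Finset.prod_const, Finset.card_univ, Fintype.card_fin, mul_comm]
  rw [accessSet, Fintype.card_piFinset, h2, ← Finset.mul_prod_erase _ _ (Finset.mem_univ i),
    ← Finset.mul_prod_erase _ (fun j => P j * s) (Finset.mem_univ i), Finset.prod_congr rfl h1,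
    if_pos rfl, card_diagonal hs]
  ring

/-! ### The repair spaces -/

variable {p : ℕ} [Fact p.Prime] {K : Type*} [Field K] [Algebra (ZMod p) K] {n : ℕ}

/-- The span of the `b_m` for the positions `m` accessed to repair node `i`. -/
noncomputable def repairSpace (p : ℕ) [Fact p.Prime] {K : Type*} [Field K] [Algebra (ZMod p) K]
    {n : ℕ} (P : Fin n → ℕ) (s : ℕ) (α β : Fin n → K) (i : Fin n) : Submodule (ZMod p) K :=
  Submodule.span (ZMod p) (bElem α β '' (accessSet P s i : Set (Pos P s)))

theorem bElem_mem_repairSpace {P : Fin n → ℕ} {s : ℕ} {α β : Fin n → K} {i : Fin n}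
    {m : Pos P s} (hm : m i ∈ diagonal (P i) s) :
    bElem α β m ∈ repairSpace p P s α β i :=
  Submodule.subset_span (s := bElem α β '' (accessSet P s i : Set (Pos P s)))
    ⟨m, mem_accessSet.mpr hm, rfl⟩

namespace IsTower

variable {s : ℕ} {P : Fin n → ℕ} {α β : Fin n → K}

/-- The access set constrains only coordinate `i`, so the `j`-th factors run through all of
`bFactor` and span every `α j ^ r * β j ^ u` with `u < s`. -/
theorem mul_mem_repairSpace (hT : IsTower p s P α β) {i j : Fin n} (hij : j ≠ i) {y : K}
    (hy : y ∈ repairSpace p P s α β i) : α j * y ∈ repairSpace p P s α β i := by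
  have hle : repairSpace p P s α β i ≤
      (repairSpace p P s α β i).comap (LinearMap.mulLeft (ZMod p) (α j)) := by
    refine Submodule.span_le.mpr ?_
    rintro _ ⟨m, hm, rfl⟩
    have hm := mem_accessSet.mp hm
    change α j * bElem α β m ∈ repairSpace p P s α β i
    rw [bElem_eq α β m j]
    set γ := ∏ r ∈ Finset.univ.erase j, bFactor (α r) (β r) (m r)
    have h1 := monomial_mul_mem_of_bFactor (repairSpace p P s α β i) (hT.α_ne_zero j)
      (hT.degree_α j) (hT.prime j).pos γ (b := β j) (s := s) fun x => by
        rw [← bElem_update]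
        refine bElem_mem_repairSpace ?_
        rwa [Function.update_of_ne hij.symm]
    rw [bFactor]
    split_ifs with hc
    · rw [← mul_assoc, ← mul_assoc, ← pow_succ', mul_assoc, Finset.sum_mul, Finset.mul_sum]
      exact Submodule.sum_mem _ fun u hu => h1 _ u (Finset.mem_range.mp hu)
    · rw [← mul_assoc, ← mul_assoc, ← pow_succ', mul_assoc]
      exact h1 _ _ (m j).2.2
  exact hle hy

/-- The translates of the repair space by the first `s` powers of `α i` generate the field. -/
theorem eq_top_of_pow_mul_repairSpace_le (hT : IsTower p s P α β) (hs : 0 < s) (i : Fin n)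
    (T : Submodule (ZMod p) K)
    (h : ∀ t < s, ∀ y ∈ repairSpace p P s α β i, α i ^ t * y ∈ T) : T = ⊤ := by
  rw [eq_top_iff, ← hT.span_bElem hs, Submodule.span_le]
  rintro _ ⟨m, rfl⟩
  -- As `s` divides `P i - 1`, the exponents of `α i` form `N` full blocks of length `s` and one
  -- last exponent `N * s`, which carries the exceptional sum.
  obtain ⟨N, hN⟩ := (Nat.modEq_iff_dvd' (hT.prime i).one_lt.le).mp (hT.modEq i).symm
  have hP1 := (hT.prime i).one_lt
  have hPN : P i = N * s + 1 := by
    rw [mul_comm]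
    omega
  have hN0 : 0 < N := by
    rcases Nat.eq_zero_or_pos N with h0 | h0
    · simp [h0] at hN
      omega
    · exact h0
  set γ := ∏ r ∈ Finset.univ.erase i, bFactor (α r) (β r) (m r) with hγ
  have hS : ∀ x ∈ diagonal (P i) s,
      bFactor (α i) (β i) x * γ ∈ repairSpace p P s α β i := by
    intro x hx
    rw [hγ, ← bElem_update]
    refine bElem_mem_repairSpace ?_
    rwa [Function.update_self]
  have h1 := monomial_mul_mem_of_diagonal T (b := β i) (hT.α_ne_zero i)
    (by rw [hT.degree_α, hPN]) hN0 γ ?_ ?_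
  · change bElem α β m ∈ T
    rw [bElem_eq α β m i, bFactor]
    split_ifs
    · rw [mul_assoc, Finset.sum_mul, Finset.mul_sum]
      exact Submodule.sum_mem _ fun u hu => h1 u (Finset.mem_range.mp hu) _
    · rw [mul_assoc]
      exact h1 _ (m i).2.2 _
  · intro q hq u hu t ht
    have hlt : q * s + u < N * s := by
      have : (q + 1) * s ≤ N * s := Nat.mul_le_mul_right s hq
      rw [add_mul] at this
      omega
    have h2 := h t ht _ (hS (⟨q * s + u, by omega⟩, ⟨u, hu⟩) ?_)
    · rw [bFactor, if_neg (by simp only; omega)] at h2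
      exact h2
    · simp only [diagonal, Finset.mem_filter, Finset.mem_univ, true_and]
      refine Or.inr ⟨by omega, ?_⟩
      rw [Nat.mul_add_mod_self_right, Nat.mod_eq_of_lt hu]
  · intro t ht
    have h2 := h t ht _ (hS (⟨N * s, by omega⟩, ⟨s - 1, by omega⟩) ?_)
    · rw [bFactor, if_pos (by simp only; omega)] at h2
      exact h2
    · simp only [diagonal, Finset.mem_filter, Finset.mem_univ, true_and]
      exact Or.inl ⟨by omega, by omega⟩

/-- The multiplier is the value at `α j` of the parity-check polynomial; it involves no `α i`
because `i ∉ E`. -/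
theorem pow_mul_prod_mul_mem_repairSpace (hT : IsTower p s P α β) {i j : Fin n} (hij : j ≠ i)
    (t : ℕ) (E : Finset (Fin n)) (hE : i ∉ E) {y : K} (hy : y ∈ repairSpace p P s α β i) :
    α j ^ t * (∏ r ∈ E, (α j - α r)) * y ∈ repairSpace p P s α β i := by
  have h1 : (∏ r ∈ E, (α j - α r)) * y ∈ repairSpace p P s α β i := by
    induction E using Finset.induction_on with
    | empty => simpa using hy
    | insert r E hr ih =>
      rw [Finset.mem_insert, not_or] at hE
      rw [Finset.prod_insert hr, mul_assoc, sub_mul]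
      exact Submodule.sub_mem _ (hT.mul_mem_repairSpace hij (ih hE.2))
        (hT.mul_mem_repairSpace (Ne.symm hE.1) (ih hE.2))
  rw [mul_assoc]
  induction t with
  | zero => simpa using h1
  | succ t ih =>
    rw [pow_succ', mul_assoc]
    exact hT.mul_mem_repairSpace hij ih

end IsTower

/-! ### Codewords -/

theorem mem_RS {k : ℕ} {α : Fin n → K} {c : Fin n → K} :
    c ∈ RS k α ↔ ∃ f : K[X], f.degree < k ∧ ∀ j, f.eval (α j) = c j := by
  simp only [RS, GRS, Submodule.mem_map, mem_degreeLT]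
  refine exists_congr fun f => and_congr_right fun _ => ?_
  rw [funext_iff]
  refine forall_congr' fun j => ?_
  simp [leval]

theorem sum_mul_eval_mul_eq_zero {k k' : ℕ} {v α : Fin n → K}
    (hv : dualCode (RS k α) = GRS k' v α) {c : Fin n → K} (hc : c ∈ RS k α) {f : K[X]}
    (hf : f.degree < k') : ∑ j, v j * f.eval (α j) * c j = 0 := by
  have h1 : (fun j => v j * f.eval (α j)) ∈ GRS k' v α :=
    ⟨f, mem_degreeLT.mpr hf, by ext j; simp [leval]⟩
  rw [← hv] at h1
  exact h1 c hc

/-- A coordinate of a codeword of a Reed-Solomon code is independent of any `k - 1` others. -/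
theorem exists_mem_RS_eq_and_eq_zero {k : ℕ} {α : Fin n → K} (hα : Function.Injective α)
    {i : Fin n} {H : Finset (Fin n)} (hi : i ∉ H) (hH : H.card + 1 ≤ k) (z : K) :
    ∃ c ∈ RS k α, c i = z ∧ ∀ j ∈ H, c j = 0 := by
  let h : K[X] := ∏ r ∈ H, (X - C (α r))
  have heval : ∀ x, h.eval x = ∏ r ∈ H, (x - α r) := fun x => by
    simp [h, eval_prod]
  have hi0 : h.eval (α i) ≠ 0 := by
    rw [heval, Finset.prod_ne_zero_iff]
    intro r hr h0
    exact hi (hα (sub_eq_zero.mp h0) ▸ hr)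
  refine ⟨fun j => ((z / h.eval (α i)) • h).eval (α j), mem_RS.mpr ⟨_, ?_, fun j => rfl⟩,
    ?_, ?_⟩
  · refine (degree_smul_le _ _).trans_lt ?_
    rw [degree_prod_of_monic _ _ fun r _ => monic_X_sub_C _]
    simp only [degree_X_sub_C, Finset.sum_const, nsmul_eq_mul, mul_one]
    exact_mod_cast hH
  · simp [hi0]
  · intro j hj
    have : h.eval (α j) = 0 := by
      rw [heval]
      exact Finset.prod_eq_zero hj (sub_self _)
    simp [this]

namespace IsTower

variable {s : ℕ} {P : Fin n → ℕ} {α β : Fin n → K}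

/-- A finite extension of the perfect field `F_p` is separable. -/
theorem nondegenerate (hT : IsTower p s P α β) (hs : 0 < s) {w : K}
    (h : ∀ y, Algebra.trace (ZMod p) K (y * w) = 0) : w = 0 := by
  have := hT.finiteDimensional hs
  refine (traceForm_nondegenerate (ZMod p) K).1 w fun y => ?_
  rw [Algebra.traceForm_apply, mul_comm]
  exact h y

/-- A codeword vanishes at node `i` if the symbols in the positions accessed to repair this node
vanish for sufficiently many other nodes. -/
theorem eq_zero_of_trace_eq_zero (hT : IsTower p s P α β) (hs : 0 < s) {k k' : ℕ}
    {v : Fin n → K} (hv0 : ∀ j, v j ≠ 0) (hv : dualCode (RS k α) = GRS k' v α)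
    {c : Fin n → K} (hc : c ∈ RS k α) {i : Fin n} (E : Finset (Fin n)) (hE : i ∉ E)
    (hEc : E.card + s ≤ k')
    (h : ∀ j, j ≠ i → j ∉ E → ∀ m ∈ accessSet P s i,
      Algebra.trace (ZMod p) K (bElem α β m * (v j * c j)) = 0) : c i = 0 := by
  have h' : ∀ j, j ≠ i → j ∉ E → ∀ y ∈ repairSpace p P s α β i,
      Algebra.trace (ZMod p) K (y * (v j * c j)) = 0 := by
    intro j hj hjE
    have hle : repairSpace p P s α β i ≤ LinearMap.ker
        ((Algebra.trace (ZMod p) K).comp (LinearMap.mulRight (ZMod p) (v j * c j))) := by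
      refine Submodule.span_le.mpr ?_
      rintro _ ⟨m, hm, rfl⟩
      exact h j hj hjE m hm
    exact fun y hy => hle hy
  set w := v i * (∏ r ∈ E, (α i - α r)) * c i with hw
  have hT0 := hT.eq_top_of_pow_mul_repairSpace_le hs i (LinearMap.ker
    ((Algebra.trace (ZMod p) K).comp (LinearMap.mulRight (ZMod p) w))) ?_
  · have hw0 : w = 0 := hT.nondegenerate hs fun y => by
      have : y ∈ LinearMap.ker
          ((Algebra.trace (ZMod p) K).comp (LinearMap.mulRight (ZMod p) w)) := by
        rw [hT0]
        trivial
      exact this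
    have hprod : ∏ r ∈ E, (α i - α r) ≠ 0 := by
      rw [Finset.prod_ne_zero_iff]
      intro r hr h0
      exact hE (hT.α_injective (sub_eq_zero.mp h0) ▸ hr)
    simpa [hw, hv0 i, hprod] using hw0
  · intro t ht y hy
    let f : K[X] := X ^ t * ∏ r ∈ E, (X - C (α r))
    have hfe : ∀ x, f.eval x = x ^ t * ∏ r ∈ E, (x - α r) := fun x => by
      simp [f, eval_prod]
    have hfd : f.degree < k' := by
      rw [degree_mul, degree_X_pow, degree_prod_of_monic _ _ fun r _ => monic_X_sub_C _]
      simp only [degree_X_sub_C, Finset.sum_const, nsmul_eq_mul, mul_one]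
      exact_mod_cast (by omega : t + E.card < k')
    have hsum := sum_mul_eval_mul_eq_zero hv hc hfd
    have h1 := congrArg (fun x => Algebra.trace (ZMod p) K (y * x)) hsum
    simp only [Finset.mul_sum, map_sum, mul_zero, map_zero] at h1
    -- Terms in `E` vanish with `f`; the others vanish because `y * f.eval (α j)` stays in the
    -- repair space.
    rw [Finset.sum_eq_single i] at h1
    · change Algebra.trace (ZMod p) K (α i ^ t * y * w) = 0
      rw [← h1, hfe, hw]
      congr 1
      ring
    · intro j _ hj
      by_cases hjE : j ∈ E
      · have : f.eval (α j) = 0 := by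
          rw [hfe, Finset.prod_eq_zero hjE (sub_self _), mul_zero]
        simp [this]
      · have := h' j hj hjE _ (hT.pow_mul_prod_mul_mem_repairSpace hj t E hE hy)
        rw [← this, hfe]
        congr 1
        ring
    · simp

end IsTower

/-! ### The array code -/

theorem sub_mem_arrayCode {F K M : Type*} [Field F] [Field K] [Algebra F K] [Fintype M]
    {C : Submodule K (Fin n → K)} {v : Fin n → K} {bs : M → K} {x x' : Fin n → M → F}
    (hx : x ∈ arrayCode C v bs) (hx' : x' ∈ arrayCode C v bs) :
    x - x' ∈ arrayCode C v bs := by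
  have h := C.sub_mem hx hx'
  change (fun j => _) ∈ C
  convert h using 1
  ext j
  simp [sub_smul, Finset.sum_sub_distrib, mul_sub]

theorem exists_mem_arrayCode {F K M : Type*} [Field F] [Field K] [Algebra F K] [Fintype M]
    {C : Submodule K (Fin n → K)} {v : Fin n → K} (hv0 : ∀ j, v j ≠ 0)
    (bs : Module.Basis M F K) {i : Fin n} {H : Finset (Fin n)}
    (hC : ∀ z : K, ∃ c ∈ C, c i = z ∧ ∀ j ∈ H, c j = 0) (z : M → F) :
    ∃ x ∈ arrayCode C v bs, x i = z ∧ ∀ j ∈ H, x j = 0 := by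
  obtain ⟨c, hc, hci, hcH⟩ := hC ((v i)⁻¹ * ∑ m, z m • bs m)
  refine ⟨fun j => bs.equivFun (v j * c j), ?_, ?_, ?_⟩
  · change (fun j => _) ∈ C
    convert hc using 1
    ext j
    rw [bs.sum_equivFun, inv_mul_cancel_left₀ (hv0 j)]
  · simp only [hci]
    rw [mul_inv_cancel_left₀ (hv0 i), ← bs.equivFun_symm_apply, LinearEquiv.apply_symm_apply]
  · intro j hj
    simp [hcH j hj]

/-- By linearity it suffices to treat the difference of the two words, whose symbols are the traces
of `b_m * v_j * c_j` by duality. -/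
theorem IsTower.eq_of_mem_arrayCode {s : ℕ} {P : Fin n → ℕ} {α β : Fin n → K}
    (hT : IsTower p s P α β) (hs : 0 < s) {k k' : ℕ}
    {v : Fin n → K} (hv0 : ∀ j, v j ≠ 0) (hv : dualCode (RS k α) = GRS k' v α)
    (bs : Module.Basis (Pos P s) (ZMod p) K)
    (hbs : ∀ m m', Algebra.trace (ZMod p) K (bElem α β m * bs m') = if m = m' then 1 else 0)
    {x x' : Fin n → Pos P s → ZMod p} (hx : x ∈ arrayCode (RS k α) v bs)
    (hx' : x' ∈ arrayCode (RS k α) v bs) {i : Fin n} (E : Finset (Fin n)) (hE : i ∉ E)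
    (hEc : E.card + s ≤ k')
    (h : ∀ j, j ≠ i → j ∉ E → ∀ m ∈ accessSet P s i, x j m = x' j m) : x i = x' i := by
  have hc := sub_mem_arrayCode hx hx'
  have h0 := hT.eq_zero_of_trace_eq_zero hs hv0 hv hc E hE hEc ?_
  · rw [mul_eq_zero, or_iff_right (inv_ne_zero (hv0 i))] at h0
    have h1 := Fintype.linearIndependent_iff.mp bs.linearIndependent _ h0
    ext m
    exact sub_eq_zero.mp (h1 m)
  · intro j hj hjE m hm
    rw [mul_inv_cancel_left₀ (hv0 j), Finset.mul_sum, map_sum]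
    simp_rw [mul_smul_comm, map_smul, hbs]
    simp [h j hj hjE m hm]

end RSRepair

theorem mainTheorem4 (p : ℕ) [Fact p.Prime] {K : Type*} [Field K] [Algebra (ZMod p) K]
    (n k d e s l : ℕ) (hk : 1 ≤ k) (hkd : 2 * e + k ≤ d) (hdn : d + 1 ≤ n)
    (hs : s = d - 2 * e - k + 1)
    (P : Fin n → ℕ) (α β : Fin n → K) (hT : RSRepair.IsTower p s P α β)
    (hl : l = s ^ n * ∏ i, P i)
    (v : Fin n → K) (hv0 : ∀ j, v j ≠ 0)
    (hv : RSRepair.dualCode (RSRepair.RS k α) = RSRepair.GRS (n - k) v α) :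
    -- the trace-dual basis of `(b_m)`
    ∃ bs : Module.Basis (RSRepair.Pos P s) (ZMod p) K,
      (∀ m m', Algebra.trace (ZMod p) K (RSRepair.bElem α β m * bs m') =
        if m = m' then 1 else 0) ∧
      -- the accessed positions, as a function of the failed node
      ∃ A : Fin n → Finset (RSRepair.Pos P s),
        (∀ i, s * (A i).card = l) ∧
        ∀ (i : Fin n) (R : Finset (Fin n)), i ∉ R → R.card = d →
          ∃ S : RSRepair.RepairScheme (ZMod p) (RSRepair.Pos P s) R,
            S.Repairs (RSRepair.arrayCode (RSRepair.RS k α) v bs) i e ∧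
            (∀ j, S.access j = A i) ∧
            s * S.bandwidth = d * l ∧
            -- no scheme with the same helpers and error tolerance downloads or accesses less
            ∀ S' : RSRepair.RepairScheme (ZMod p) (RSRepair.Pos P s) R,
              S'.Repairs (RSRepair.arrayCode (RSRepair.RS k α) v bs) i e →
              S.bandwidth ≤ S'.bandwidth ∧ S.totalAccess ≤ S'.totalAccess := by
  have hs0 : 0 < s := by omega
  have := hT.finiteDimensional hs0
  obtain ⟨b, hb⟩ := hT.exists_basis hs0
  have hdual : ∀ m m', Algebra.trace (ZMod p) K (RSRepair.bElem α β m * b.traceDual m') =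
      if m = m' then 1 else 0 := by
    intro m m'
    rw [← hb, b.trace_mul_traceDual]
  refine ⟨b.traceDual, hdual, RSRepair.accessSet P s,
    fun i => by rw [RSRepair.mul_card_accessSet P hs0, hl], ?_⟩
  intro i R hi hR
  obtain ⟨S, hS, hA, hbw, hta⟩ := RSRepair.RepairScheme.exists_repairs_of_access (R := R)
    (RSRepair.arrayCode (RSRepair.RS k α) v b.traceDual) i e (RSRepair.accessSet P s i) (by
      intro x hx x' hx' B hB h
      have hcard : (insert i R)ᶜ.card + (d + 1) = n := by
        rw [← hR, ← Finset.card_insert_of_notMem hi, Finset.card_compl_add_card,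
          Fintype.card_fin]
      -- Non-helpers and disagreeing helpers number at most `(n - d - 1) + 2 * e`, and adding `s`
      -- gives exactly `n - k`.
      refine hT.eq_of_mem_arrayCode hs0 hv0 hv b.traceDual hdual hx hx'
        ((insert i R)ᶜ ∪ B.map (Function.Embedding.subtype _)) ?_ ?_ ?_
      · simp [hi]
      · have := Finset.card_union_le (insert i R)ᶜ (B.map (Function.Embedding.subtype _))
        rw [Finset.card_map] at this
        omega
      · intro j hji hj
        have hjR : j ∈ R := by
          by_contra hjR
          simp [hji, hjR] at hj
        refine h ⟨j, hjR⟩ fun hjB => hj ?_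
        exact Finset.mem_union_right _ (Finset.mem_map_of_mem _ hjB))
  have hcA := RSRepair.mul_card_accessSet P hs0 i
  rw [← hl] at hcA
  have hbl : s * S.bandwidth = d * l := by
    rw [hbw, hR, ← hcA]
    ring
  refine ⟨S, hS, hA, hbl, fun S' hS' => ?_⟩
  have hM : Fintype.card (RSRepair.Pos P s) = l := by
    simp [hl, Finset.prod_mul_distrib, mul_comm]
  have hbd := RSRepair.RepairScheme.mul_card_le_of_repairs (k := k) (s := s) hS'
    (fun H hiH hH z => RSRepair.exists_mem_arrayCode hv0 b.traceDual
      (RSRepair.exists_mem_RS_eq_and_eq_zero hT.α_injective hiH hH) z) hi hk hs0 (by omega)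
  rw [hM, hR, ← hbl] at hbd
  have hta' : S.totalAccess = S.bandwidth := by rw [hta, hbw]
  rw [hta']
  exact ⟨Nat.le_of_mul_le_mul_left hbd.1 hs0, Nat.le_of_mul_le_mul_left hbd.2 hs0⟩
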